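/- Let $S$ and $A$ be finite sets of states and actions, $p(j\mid i,a)$ transition probabilities, $c(i,a,j)$ rewards with $|c(i,a,j)|\le C_{\max}$ for all $(i,a,j)$, and $\beta\in[0,1)$ a discount factor. Let $s_0,a_0,s'_0,a'_0,s_1,a_1,s'_1,a'_1,s_2,\dots$ be a trajectory of this Markov decision process: given the past up to and including the current state and action, the next state has law $p(\cdot\mid\text{current state, current action})$, and the next action is drawn at that state from the behaviour policy $\mu$, which may be a fixed policy or may depend on the past. Put $s''_n=s_{n+1}$. Let $Q_0\in\mathbb R^{S\times A}$ be an initial vector, let $\alpha_n(i,a)$ be step sizes (both possibly random; $Q_0$ is known at the start and $\alpha_n$ is known once $(s_n,a_n)$ is), let $(\theta_n)_{n\ge 0}$ be real numbers, and define the two-step Q-learning iterates by $$Q_{n+1}(s_n,a_n)=(1-\alpha_n(s_n,a_n))Q_n(s_n,a_n)+\alpha_n(s_n,a_n)\Big(c(s_n,a_n,s'_n)+\beta\max_{b\in A}Q_n(s'_n,b)+\beta\theta_n\big(c(s'_n,a'_n,s''_n)+\beta\max_{e\in A}Q_n(s''_n,e)\big)\Big),$$ and $Q_{n+1}(i,a)=Q_n(i,a)$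 for $(i,a)\ne(s_n,a_n)$. Assume that 1. almost surely, every state-action pair $(i,a)$ equals $(s_n,a_n)$ for infinitely many $n$; 2. $\|Q_0\|\le C_{\max}/(1-\beta)$ in the maximum norm; 3. $0\le\alpha_n(i,a)\le 1$ for all $n,i,a$ and, almost surely, for all $(i,a)$, $\sum_{n}\alpha_n(i,a)=\infty$ and $\sum_{n}\alpha_n(i,a)^2<\infty$, both sums being over those $n$ at which $(i,a)$ is updated, i.e. $(s_n,a_n)=(i,a)$; 4. $|\theta_n|\le 1$ for all $n$, $|\theta_n|$ decreases monotonically (in the weak sense) to $0$, and, almost surely, $\sum_{n}\alpha_n(i,a)|\theta_n|<\infty$ for all $(i,a)$, the sum being over the same $n$. Then the Bellman operator $$(HQ)(i,a)=\sum_{j\in S}p(j\mid i,a)\,c(i,a,j)+\beta\sum_{j\in S}p(j\mid i,a)\max_{b\in A}Q(j,b)$$ has a unique fixed point $Q^*$, and $Q_n\to Q^*$ almost surely. -/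

import Mathlib

open MeasureTheory Filter Topology
open scoped ProbabilityTheory

namespace TSQL

/-- A discounted Markov decision process with state space `S` and action space `A`:
`p i a j` is the probability of moving to `j` when `a` is chosen in `i`, `c i a j` is the
reward of that move and `β` is the discount factor. -/
structure MDP (S A : Type*) [Fintype S] where
  p : S → A → S → ℝ
  p_nonneg : ∀ i a j, 0 ≤ p i a j
  p_sum : ∀ i a, ∑ j, p i a j = 1
  c : S → A → S → ℝ
  β : ℝ
  β_nonneg : 0 ≤ β
  β_lt_one : β < 1

/-- A policy: a map from states to probability distributions over the actions. -/
structure IsPolicy {S A : Type*} [Fintype A] (π : S → A → ℝ) : Prop where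
  nonneg : ∀ i a, 0 ≤ π i a
  sum_eq_one : ∀ i, ∑ a, π i a = 1

/-- `maxQ Q j = max_b Q(j, b)`. -/
noncomputable def maxQ {S A : Type*} [Fintype A] [Nonempty A] (Q : S → A → ℝ) (j : S) : ℝ :=
  Finset.univ.sup' Finset.univ_nonempty (fun b => Q j b)

/-- The expected one-step reward `c(i, a) = ∑_j p(j | i, a) c(i, a, j)`. -/
noncomputable def MDP.meanReward {S A : Type*} [Fintype S] (M : MDP S A) (i : S) (a : A) : ℝ :=
  ∑ j, M.p i a j * M.c i a j

/-- The Bellman operator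
`(H Q)(i, a) = c(i, a) + β ∑_j p(j | i, a) max_b Q(j, b)`. -/
noncomputable def MDP.bellman {S A : Type*} [Fintype S] [Fintype A] [Nonempty A] (M : MDP S A)
    (Q : S → A → ℝ) : S → A → ℝ :=
  fun i a => M.meanReward i a + M.β * ∑ j, M.p i a j * maxQ Q j

/-- One update of two-step Q-learning with step sizes `α`, parameter `θ` and sample
`(i, a, j, c(i, a, j), d, k, c(j, d, k))`: only the entry at `(i, a)` changes. -/
noncomputable def MDP.update {S A : Type*} [Fintype S] [Fintype A] [Nonempty A]
    [DecidableEq S] [DecidableEq A] (M : MDP S A) (α : S → A → ℝ) (θ : ℝ) (Q : S → A → ℝ)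
    (i : S) (a : A) (j : S) (d : A) (k : S) : S → A → ℝ :=
  fun s b =>
    if s = i ∧ b = a then
      (1 - α i a) * Q i a
        + α i a * (M.c i a j + M.β * maxQ Q j + M.β * θ * (M.c j d k + M.β * maxQ Q k))
    else Q s b

/-- The iterates `Q_n` of two-step Q-learning along the trajectory
`x 0, u 0, x 1, u 1, x 2, …` of states and actions. Each iteration consumes two transitions:
in the `n`-th one, `s_n = x (2n)`, `a_n = u (2n)`, `s'_n = x (2n+1)`, `a'_n = u (2n+1)` and
`s''_n = x (2n+2) = s_{n+1}`. -/
noncomputable def MDP.iterate {S A : Type*} [Fintype S] [Fintype A] [Nonempty A]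
    [DecidableEq S] [DecidableEq A] (M : MDP S A) (α : ℕ → S → A → ℝ) (θ : ℕ → ℝ)
    (Q₀ : S → A → ℝ) (x : ℕ → S) (u : ℕ → A) : ℕ → S → A → ℝ
  | 0 => Q₀
  | n + 1 =>
      M.update (α n) (θ n) (M.iterate α θ Q₀ x u n)
        (x (2 * n)) (u (2 * n)) (x (2 * n + 1)) (u (2 * n + 1)) (x (2 * n + 2))

/-- The step size that the `n`-th iteration applies to the entry `(i, a)`: it is `α_n(i, a)` if
`(i, a)` is the pair `(s_n, a_n)` updated in that iteration, and `0` otherwise. -/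
noncomputable def stepAt {S A : Type*} [DecidableEq S] [DecidableEq A] (α : ℕ → S → A → ℝ)
    (x : ℕ → S) (u : ℕ → A) (i : S) (a : A) (n : ℕ) : ℝ :=
  if i = x (2 * n) ∧ a = u (2 * n) then α n i a else 0

/-- The states `x t` and actions `u t` form a trajectory of the process `M`, where `𝒢 t` is the
information available once `x t` and `u t` are known, and where the action at time `t + 1` is
drawn from the policy `μ t`. This policy may depend on the past up to time `t`; a fixed policy
is the case of a constant `μ`. The initial pair `(x 0, u 0)` is arbitrary. -/
structure IsTrajectory {S A Ω : Type*} [Fintype S] [Fintype A] {mΩ : MeasurableSpace Ω}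
    (M : MDP S A) (P : Measure Ω) (𝒢 : Filtration ℕ mΩ) (μ : ℕ → Ω → S → A → ℝ)
    (x : ℕ → Ω → S) (u : ℕ → Ω → A) : Prop where
  policy : ∀ t ω, IsPolicy (μ t ω)
  policy_meas : ∀ t i a, Measurable[𝒢 t] (fun ω => μ t ω i a)
  state_meas : ∀ t i, MeasurableSet[𝒢 t] {ω | x t ω = i}
  action_meas : ∀ t a, MeasurableSet[𝒢 t] {ω | u t ω = a}
  transition : ∀ t j d,
    P⟦{ω | x (t + 1) ω = j ∧ u (t + 1) ω = d} | 𝒢 t⟧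
      =ᵐ[P] fun ω => M.p (x t ω) (u t ω) j * μ t ω j d

end TSQL

namespace TSQL

/-! Each update relaxes the entry at `(s_n, a_n)` towards `H Q_n + ξ_n + e_n`. Here `ξ_n` is the
deviation of the one-step sample `c(s_n, a_n, s'_n) + β max Q_n(s'_n, ·)` from its conditional mean,
and `e_n` is the whole two-step term, treated as bias. The iterates are bounded: once `|θ_n|` is
small against `1 - β`, the factor `1 + β|θ_n|` cannot undo the discounting. Hence `e_n → 0` along
with `θ_n`, while the `ξ_n` are bounded martingale differences, so square-summable steps make the
noise series converge almost surely (`ae_exists_tendsto_sum_of_summable_sq`).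

The rest is pathwise (`tendsto_fixedPoint_of_async_approximation`). Adding the tail of the noise
series to `Q_n` leaves a noise-free relaxation with vanishing error. Since `H` contracts in the
maximum norm, a bound `E` on the distance to `Q*` eventually improves to `ρ E` with a fixed `ρ < 1`:
the steps at each entry have infinite sum, so every entry is pulled down, each at its own pace.
Iterating drives the distance to zero. -/

/-- Relaxation towards `r` with non-summable step sizes ends up below every `r' > r`. -/
theorem eventually_le_of_relaxation {a y : ℕ → ℝ} {r r' : ℝ} (hr : r < r') (N : ℕ)
    (ha : ∀ n, 0 ≤ a n ∧ a n ≤ 1)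
    (hsum : Tendsto (fun n => ∑ k ∈ Finset.range n, a k) atTop atTop)
    (hy : ∀ n, N ≤ n → y (n + 1) ≤ (1 - a n) * y n + a n * r) :
    ∀ᶠ n in atTop, y n ≤ r' := by
  set A : ℕ → ℝ := fun n => ∑ k ∈ Finset.range n, a k with hA
  -- The excess over `r` shrinks by `1 - a n ≤ exp (-a n)` at each step, so the sum of the steps
  -- appears in the exponent.
  have key : ∀ n, N ≤ n → y n - r ≤ |y N - r| * Real.exp (-(A n - A N)) := by
    intro n hn
    induction n, hn using Nat.le_induction with
    | base => simpa using le_abs_self (y N - r)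
    | succ n hn ih =>
      have hexp : Real.exp (-(A (n + 1) - A N))
          = Real.exp (-(A n - A N)) * Real.exp (-a n) := by
        rw [← Real.exp_add]
        congr 1
        simp only [hA, Finset.sum_range_succ]
        ring
      have h1 : 1 - a n ≤ Real.exp (-a n) := by
        have := Real.add_one_le_exp (-a n)
        linarith
      have h2 : 0 ≤ |y N - r| * Real.exp (-(A n - A N)) := by positivity
      calc y (n + 1) - r ≤ (1 - a n) * (y n - r) := by
            have := hy n hn
            linarith
        _ ≤ (1 - a n) * (|y N - r| * Real.exp (-(A n - A N))) :=
            mul_le_mul_of_nonneg_left ih (by linarith [(ha n).2])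
        _ ≤ Real.exp (-a n) * (|y N - r| * Real.exp (-(A n - A N))) :=
            mul_le_mul_of_nonneg_right h1 h2
        _ = |y N - r| * Real.exp (-(A (n + 1) - A N)) := by rw [hexp]; ring
  have hlim : Tendsto (fun n => |y N - r| * Real.exp (-(A n - A N))) atTop (𝓝 0) := by
    have h1 : Tendsto (fun n => A n - A N) atTop atTop :=
      tendsto_atTop_add_const_right _ _ hsum
    simpa using (Real.tendsto_exp_neg_atTop_nhds_zero.comp h1).const_mul |y N - r|
  filter_upwards [hlim.eventually_lt_const (sub_pos.2 hr), eventually_ge_atTop N] with n h1 h2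
  linarith [key n h2]

/-! ### Pathwise asynchronous stochastic approximation -/

section Approximation

variable {S A : Type*} [Fintype S] [Fintype A]

theorem abs_apply_le_norm (Q : S → A → ℝ) (i : S) (a : A) : |Q i a| ≤ ‖Q‖ :=
  (norm_le_pi_norm (Q i) a).trans (norm_le_pi_norm Q i)

theorem norm_le_of_abs_apply_le {Q : S → A → ℝ} {r : ℝ} (hr : 0 ≤ r)
    (h : ∀ i a, |Q i a| ≤ r) : ‖Q‖ ≤ r :=
  (pi_norm_le_iff_of_nonneg hr).2 fun i => (pi_norm_le_iff_of_nonneg hr).2 fun a => h i a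

/-- A nonnegative, bounded family that asynchronously contracts in the maximum norm, up to a
vanishing error, tends to zero. -/
theorem tendsto_zero_of_async_contraction {β D : ℝ} (hβ : 0 ≤ β) (hβ1 : β < 1)
    {a y : ℕ → S → A → ℝ} {ε : ℕ → ℝ}
    (ha : ∀ n i b, 0 ≤ a n i b ∧ a n i b ≤ 1)
    (hsum : ∀ i b, Tendsto (fun n => ∑ k ∈ Finset.range n, a k i b) atTop atTop)
    (hε : Tendsto ε atTop (𝓝 0)) (hy0 : ∀ n i b, 0 ≤ y n i b) (hD : ∀ n, ‖y n‖ ≤ D)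
    (hy : ∀ n i b, y (n + 1) i b
      ≤ (1 - a n i b) * y n i b + a n i b * (β * ‖y n‖ + ε n)) :
    Tendsto y atTop (𝓝 0) := by
  have hD0 : 0 ≤ D := (norm_nonneg _).trans (hD 0)
  -- The midpoint of `β` and `1` leaves a gap `ρ - β = (1 - β) / 2`; half of it absorbs the error
  -- `ε`, the other half gives the strict inequality that relaxation needs. Using `D + 1` keeps the
  -- bounds positive even if `D = 0`.
  set ρ : ℝ := (1 + β) / 2 with hρ
  have hρ0 : 0 < ρ := by linarith
  have hρ1 : ρ < 1 := by linarith
  have key : ∀ k : ℕ, ∀ᶠ n in atTop, ‖y n‖ ≤ ρ ^ k * (D + 1) := by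
    intro k
    induction k with
    | zero => exact Eventually.of_forall fun n => by simpa using (hD n).trans (by linarith)
    | succ k ih =>
      set E : ℝ := ρ ^ k * (D + 1) with hE
      have hE0 : 0 < E := by positivity
      have hr : β * E + (1 - β) / 4 * E < ρ ^ (k + 1) * (D + 1) := by
        have : ρ ^ (k + 1) * (D + 1) = ρ * E := by rw [hE]; ring
        rw [this, hρ]
        nlinarith
      have hεE : ∀ᶠ n in atTop, ε n < (1 - β) / 4 * E :=
        hε.eventually_lt_const (by apply mul_pos _ hE0; linarith)
      obtain ⟨N, hN⟩ := eventually_atTop.1 (ih.and hεE)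
      have hall : ∀ i b, ∀ᶠ n in atTop, y n i b ≤ ρ ^ (k + 1) * (D + 1) := by
        intro i b
        refine eventually_le_of_relaxation hr N (fun n => ha n i b) (hsum i b) fun n hn => ?_
        refine (hy n i b).trans ?_
        obtain ⟨h1, h2⟩ := hN n hn
        have h3 : β * ‖y n‖ ≤ β * E := mul_le_mul_of_nonneg_left h1 hβ
        have h4 : a n i b * (β * ‖y n‖ + ε n) ≤ a n i b * (β * E + (1 - β) / 4 * E) :=
          mul_le_mul_of_nonneg_left (by linarith) (ha n i b).1
        linarith
      have hall' : ∀ᶠ n in atTop, ∀ i b, y n i b ≤ ρ ^ (k + 1) * (D + 1) :=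
        eventually_all.2 fun i => eventually_all.2 fun b => hall i b
      filter_upwards [hall'] with n hn
      refine norm_le_of_abs_apply_le (by positivity) fun i b => ?_
      rw [abs_of_nonneg (hy0 n i b)]
      exact hn i b
  rw [tendsto_zero_iff_norm_tendsto_zero, Metric.tendsto_atTop']
  intro δ hδ
  have hlim : Tendsto (fun k : ℕ => ρ ^ k * (D + 1)) atTop (𝓝 0) := by
    simpa using (tendsto_pow_atTop_nhds_zero_of_lt_one hρ0.le hρ1).mul_const (D + 1)
  obtain ⟨k, hk⟩ := (hlim.eventually_lt_const hδ).exists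
  obtain ⟨N, hN⟩ := eventually_atTop.1 (key k)
  refine ⟨N, fun n hn => ?_⟩
  rw [dist_zero_right, norm_norm]
  exact (hN n hn.le).trans_lt hk

/-- Asynchronous stochastic approximation of the fixed point `q` of a maximum-norm contraction,
pathwise: bounded iterates converge if the noise series converge and the bias vanishes. -/
theorem tendsto_fixedPoint_of_async_approximation {β B : ℝ} (hβ : 0 ≤ β) (hβ1 : β < 1)
    {H : (S → A → ℝ) → S → A → ℝ} {q : S → A → ℝ} (hH : ∀ Q, ‖H Q - q‖ ≤ β * ‖Q - q‖)
    {a Q w e : ℕ → S → A → ℝ}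
    (ha : ∀ n i b, 0 ≤ a n i b ∧ a n i b ≤ 1)
    (hsum : ∀ i b, Tendsto (fun n => ∑ k ∈ Finset.range n, a k i b) atTop atTop)
    (hB : ∀ n, ‖Q n‖ ≤ B)
    (hw : ∀ i b, ∃ l, Tendsto (fun n => ∑ k ∈ Finset.range n, a k i b * w k i b) atTop (𝓝 l))
    (he : Tendsto e atTop (𝓝 0))
    (hQ : ∀ n i b, Q (n + 1) i b
      = (1 - a n i b) * Q n i b + a n i b * (H (Q n) i b + w n i b + e n i b)) :
    Tendsto Q atTop (𝓝 q) := by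
  choose l hl using hw
  -- The tail of the noise series: `r (n + 1) - r n = -a n * w n`, so the noise cancels in the
  -- recursion for `Q + r`, and `r` survives only as a bias.
  set r : ℕ → S → A → ℝ :=
    fun n i b => l i b - ∑ k ∈ Finset.range n, a k i b * w k i b with hr
  have hr0 : Tendsto r atTop (𝓝 0) := by
    refine tendsto_pi_nhds.2 fun i => tendsto_pi_nhds.2 fun b => ?_
    simpa [hr] using (hl i b).const_sub (l i b)
  obtain ⟨R, hR⟩ : ∃ R, ∀ n, ‖r n‖ ≤ R := by
    obtain ⟨R, hR⟩ := (Metric.isBounded_range_of_tendsto r hr0).exists_norm_le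
    exact ⟨R, fun n => hR _ ⟨n, rfl⟩⟩
  set Z : ℕ → S → A → ℝ := fun n => Q n + r n with hZ
  have hZs : ∀ n i b, Z (n + 1) i b
      = (1 - a n i b) * Z n i b + a n i b * (H (Q n) i b + r n i b + e n i b) := by
    intro n i b
    simp only [hZ, hr, Pi.add_apply, hQ, Finset.sum_range_succ]
    ring
  set y : ℕ → S → A → ℝ := fun n i b => |Z n i b - q i b| with hy
  have hyn : ∀ n, ‖y n‖ = ‖Z n - q‖ := by
    intro n
    apply le_antisymm
    · refine norm_le_of_abs_apply_le (norm_nonneg _) fun i b => ?_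
      simpa [hy] using abs_apply_le_norm (Z n - q) i b
    · refine norm_le_of_abs_apply_le (norm_nonneg _) fun i b => ?_
      simpa [hy] using abs_apply_le_norm (y n) i b
  have hy_lim : Tendsto y atTop (𝓝 0) := by
    -- One `‖r n‖` is the bias in the recursion for `Z`; the other pays for replacing `‖Q n - q‖` by
    -- `‖Z n - q‖`.
    refine tendsto_zero_of_async_contraction (β := β) (D := B + R + ‖q‖)
      (ε := fun n => 2 * ‖r n‖ + ‖e n‖) hβ hβ1 ha hsum ?_ (fun n i b => abs_nonneg _) ?_ ?_
    · simpa using (hr0.norm.const_mul 2).add he.norm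
    · intro n
      rw [hyn]
      calc ‖Q n + r n - q‖ ≤ ‖Q n + r n‖ + ‖q‖ := norm_sub_le _ _
        _ ≤ ‖Q n‖ + ‖r n‖ + ‖q‖ := by gcongr; exact norm_add_le _ _
        _ ≤ _ := by gcongr; exacts [hB n, hR n]
    · intro n i b
      obtain ⟨h0, h1⟩ := ha n i b
      have h2 : |H (Q n) i b - q i b| ≤ β * ‖Z n - q‖ + ‖r n‖ := by
        have e1 : |H (Q n) i b - q i b| ≤ β * ‖Q n - q‖ :=
          (abs_apply_le_norm (H (Q n) - q) i b).trans (hH _)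
        have e2 : ‖Q n - q‖ ≤ ‖Z n - q‖ + ‖r n‖ := by
          have : Q n - q = (Z n - q) - r n := by simp only [hZ]; abel
          rw [this]
          exact norm_sub_le _ _
        nlinarith [norm_nonneg (r n)]
      have h3 := abs_apply_le_norm (r n) i b
      have h4 := abs_apply_le_norm (e n) i b
      rw [hyn]
      have h5 : Z (n + 1) i b - q i b = (1 - a n i b) * (Z n i b - q i b)
          + a n i b * ((H (Q n) i b - q i b) + r n i b + e n i b) := by rw [hZs]; ring
      have h6 : |(H (Q n) i b - q i b) + r n i b + e n i b|
          ≤ β * ‖Z n - q‖ + (2 * ‖r n‖ + ‖e n‖) :=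
        (abs_add_three _ _ _).trans (by linarith)
      calc y (n + 1) i b = |Z (n + 1) i b - q i b| := rfl
        _ ≤ |(1 - a n i b) * (Z n i b - q i b)|
            + |a n i b * ((H (Q n) i b - q i b) + r n i b + e n i b)| := by
          rw [h5]; exact abs_add_le _ _
        _ = (1 - a n i b) * |Z n i b - q i b|
            + a n i b * |(H (Q n) i b - q i b) + r n i b + e n i b| := by
          rw [abs_mul, abs_mul, abs_of_nonneg h0, abs_of_nonneg (sub_nonneg.2 h1)]
        _ ≤ _ := add_le_add le_rfl (mul_le_mul_of_nonneg_left h6 h0)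
  have hZlim : Tendsto (fun n => Z n - q) atTop (𝓝 0) := by
    rw [tendsto_zero_iff_norm_tendsto_zero]
    simpa only [hyn] using tendsto_zero_iff_norm_tendsto_zero.1 hy_lim
  have : Tendsto (fun n => (Z n - q) - r n + q) atTop (𝓝 (0 - 0 + q)) :=
    (hZlim.sub hr0).add_const q
  have hQZ : ∀ n, Z n - q - r n + q = Q n := fun n => by
    simp only [hZ]
    abel
  simpa only [hQZ, sub_zero, zero_add] using this

end Approximation

/-! ### Almost sure convergence of martingale series -/

section Martingale

variable {Ω : Type*} {mΩ : MeasurableSpace Ω} {P : Measure Ω} [IsProbabilityMeasure P]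

/-- Series of bounded martingale differences, with predictable weights whose squares have a
deterministically bounded sum, converge almost surely. -/
theorem ae_exists_tendsto_sum_of_bounded_sum_sq {ℱ : Filtration ℕ mΩ} {b ξ : ℕ → Ω → ℝ}
    {C L : ℝ} (hb : ∀ n, Measurable[ℱ n] (b n)) (hξ : ∀ n, Measurable[ℱ (n + 1)] (ξ n))
    (hC : ∀ n ω, |ξ n ω| ≤ C) (hξ0 : ∀ n, P[ξ n | ℱ n] =ᵐ[P] 0)
    (hL : ∀ n ω, ∑ k ∈ Finset.range n, b k ω ^ 2 ≤ L) :
    ∀ᵐ ω ∂P, ∃ l, Tendsto (fun n => ∑ k ∈ Finset.range n, b k ω * ξ k ω) atTop (𝓝 l) := by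
  set X : ℕ → Ω → ℝ := fun n ω => ∑ k ∈ Finset.range n, b k ω * ξ k ω with hX
  have hbb : ∀ n ω, |b n ω| ≤ L + 1 := by
    intro n ω
    have h1 := hL (n + 1) ω
    rw [Finset.sum_range_succ] at h1
    have h2 : 0 ≤ ∑ k ∈ Finset.range n, b k ω ^ 2 := Finset.sum_nonneg fun _ _ => sq_nonneg _
    have h3 : |b n ω| ^ 2 ≤ L := by rw [sq_abs]; linarith
    nlinarith [sq_nonneg (|b n ω| - 1)]
  have hdm : ∀ n, Measurable[ℱ (n + 1)] (fun ω => b n ω * ξ n ω) := fun n =>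
    ((hb n).mono (ℱ.mono n.le_succ) le_rfl).mul (hξ n)
  have hXm : ∀ n, Measurable[ℱ n] (X n) := fun n =>
    Finset.measurable_fun_sum _ fun k hk =>
      (hdm k).mono (ℱ.mono (Finset.mem_range.1 hk)) le_rfl
  have hdb : ∀ n ω, |b n ω * ξ n ω| ≤ (L + 1) * C := by
    intro n ω
    rw [abs_mul]
    exact mul_le_mul (hbb n ω) (hC n ω) (abs_nonneg _) ((abs_nonneg _).trans (hbb n ω))
  have hXb : ∀ n ω, |X n ω| ≤ n * ((L + 1) * C) := by
    intro n ω
    refine (Finset.abs_sum_le_sum_abs _ _).trans ?_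
    refine (Finset.sum_le_sum fun k _ => hdb k ω).trans ?_
    simp
  have hint : ∀ {f : Ω → ℝ} {K : ℝ}, Measurable f → (∀ ω, |f ω| ≤ K) → Integrable f P :=
    fun hf hK => Integrable.of_bound hf.aestronglyMeasurable _ (Eventually.of_forall hK)
  have hξi : ∀ n, Integrable (ξ n) P := fun n =>
    hint ((hξ n).mono (ℱ.le _) le_rfl) (hC n)
  have hXi : ∀ n, Integrable (X n) P := fun n => hint ((hXm n).mono (ℱ.le _) le_rfl) (hXb n)
  have hpull : ∀ n {g : Ω → ℝ} {K : ℝ}, Measurable[ℱ n] g → (∀ ω, |g ω| ≤ K) →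
      P[fun ω => g ω * ξ n ω | ℱ n] =ᵐ[P] 0 := by
    intro n g K hg hK
    have h1 : P[g * ξ n | ℱ n] =ᵐ[P] g * P[ξ n | ℱ n] :=
      condExp_mul_of_stronglyMeasurable_left hg.stronglyMeasurable
        ((hξi n).bdd_mul (hg.mono (ℱ.le _) le_rfl).aestronglyMeasurable
          (Eventually.of_forall hK)) (hξi n)
    filter_upwards [h1, hξ0 n] with ω h1 h2
    rw [show (fun ω => g ω * ξ n ω) = g * ξ n from rfl, h1, Pi.mul_apply, h2]
    simp
  have hmart : Martingale X ℱ P := by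
    refine martingale_of_condExp_sub_eq_zero_nat (fun n => (hXm n).stronglyMeasurable) hXi ?_
    intro n
    have : X (n + 1) - X n = fun ω => b n ω * ξ n ω := by
      ext ω
      simp [hX, Finset.sum_range_succ]
    rw [this]
    exact hpull n (hb n) (hbb n)
  have hXsq : ∀ n, Integrable (fun ω => X n ω ^ 2) P := fun n =>
    hint (K := (n * ((L + 1) * C)) ^ 2) (((hXm n).mono (ℱ.le _) le_rfl).pow_const 2)
      fun ω => by
        rw [abs_pow]
        exact pow_le_pow_left₀ (abs_nonneg _) (hXb n ω) 2
  -- Martingale increments are orthogonal: the cross term vanishes on conditioning on `ℱ n`, so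
  -- second moments add up. The resulting `L²` bound gives the `L¹` bound required by martingale
  -- convergence.
  have hsq : ∀ n, ∫ ω, X n ω ^ 2 ∂P ≤ ∫ ω, C ^ 2 * ∑ k ∈ Finset.range n, b k ω ^ 2 ∂P := by
    intro n
    have hbsi : ∀ n, Integrable (fun ω => b n ω ^ 2) P := fun n =>
      hint (K := (L + 1) ^ 2) (((hb n).mono (ℱ.le _) le_rfl).pow_const 2) fun ω => by
        rw [abs_pow]
        exact pow_le_pow_left₀ (abs_nonneg _) (hbb n ω) 2
    have hbsum : ∀ n, Integrable (fun ω => C ^ 2 * ∑ k ∈ Finset.range n, b k ω ^ 2) P :=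
      fun n => (integrable_finsetSum _ fun k _ => hbsi k).const_mul _
    induction n with
    | zero => simp [hX]
    | succ n ih =>
      have hcm : Measurable[ℱ n] (fun ω => 2 * X n ω * b n ω) :=
        ((hXm n).const_mul 2).mul (hb n)
      have hcb : ∀ ω, |2 * X n ω * b n ω| ≤ 2 * (n * ((L + 1) * C)) * (L + 1) := fun ω => by
        rw [abs_mul, abs_mul, abs_two]
        have := hXb n ω
        exact mul_le_mul (by linarith) (hbb n ω) (abs_nonneg _)
          (by linarith [abs_nonneg (X n ω)])
      have hci : Integrable (fun ω => 2 * X n ω * b n ω * ξ n ω) P :=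
        (hξi n).bdd_mul (hcm.mono (ℱ.le _) le_rfl).aestronglyMeasurable
          (Eventually.of_forall hcb)
      have hcross : ∫ ω, 2 * X n ω * b n ω * ξ n ω ∂P = 0 := by
        rw [← integral_condExp (ℱ.le n), integral_congr_ae (hpull n hcm hcb)]
        simp
      have hd2 : Integrable (fun ω => (b n ω * ξ n ω) ^ 2) P :=
        hint (K := ((L + 1) * C) ^ 2) (((hdm n).mono (ℱ.le _) le_rfl).pow_const 2)
          fun ω => by
            rw [abs_pow]
            exact pow_le_pow_left₀ (abs_nonneg _) (hdb n ω) 2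
      have hexp : ∀ ω, X (n + 1) ω ^ 2
          = X n ω ^ 2 + 2 * X n ω * b n ω * ξ n ω + (b n ω * ξ n ω) ^ 2 := by
        intro ω
        simp only [hX, Finset.sum_range_succ]
        ring
      have hle : ∫ ω, (b n ω * ξ n ω) ^ 2 ∂P ≤ ∫ ω, C ^ 2 * b n ω ^ 2 ∂P := by
        refine integral_mono hd2 ((hbsi n).const_mul _) fun ω => ?_
        have : ξ n ω ^ 2 ≤ C ^ 2 := sq_le_sq' (abs_le.1 (hC n ω)).1 (abs_le.1 (hC n ω)).2
        nlinarith [sq_nonneg (b n ω)]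
      have hXci : Integrable (fun ω => X n ω ^ 2 + 2 * X n ω * b n ω * ξ n ω) P :=
        (hXsq n).add hci
      simp_rw [hexp, Finset.sum_range_succ, mul_add]
      rw [integral_add hXci hd2, integral_add (hXsq n) hci, hcross,
        integral_add (hbsum n) ((hbsi n).const_mul _)]
      linarith
  have hL1 : ∀ n, ∫ ω, |X n ω| ∂P ≤ 1 + C ^ 2 * L := by
    intro n
    have h1 : ∫ ω, |X n ω| ∂P ≤ ∫ ω, (1 + X n ω ^ 2) ∂P := by
      refine integral_mono (hXi n).abs ((integrable_const 1).add (hXsq n)) fun ω => ?_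
      have := sq_abs (X n ω)
      simp only
      nlinarith [sq_nonneg (|X n ω| - 1)]
    have h2 : ∫ ω, C ^ 2 * ∑ k ∈ Finset.range n, b k ω ^ 2 ∂P ≤ C ^ 2 * L := by
      have : ∫ ω, C ^ 2 * ∑ k ∈ Finset.range n, b k ω ^ 2 ∂P ≤ ∫ _, C ^ 2 * L ∂P := by
        refine integral_mono_of_nonneg (Eventually.of_forall fun ω => ?_)
          (integrable_const _) (Eventually.of_forall fun ω => ?_)
        · exact mul_nonneg (sq_nonneg C) (Finset.sum_nonneg fun _ _ => sq_nonneg _)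
        · exact mul_le_mul_of_nonneg_left (hL n ω) (sq_nonneg C)
      simpa using this
    rw [integral_add (integrable_const 1) (hXsq n)] at h1
    simp only [integral_const, probReal_univ, smul_eq_mul, one_mul] at h1
    linarith [hsq n]
  have hbdd : ∀ n, eLpNorm (X n) 1 P ≤ ((1 + C ^ 2 * L).toNNReal : ENNReal) := by
    intro n
    rw [eLpNorm_one_eq_lintegral_enorm, ← ofReal_integral_norm_eq_lintegral_enorm (hXi n)]
    exact ENNReal.ofReal_le_ofReal (hL1 n)
  filter_upwards [hmart.submartingale.ae_tendsto_limitProcess hbdd] with ω hω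
  exact ⟨_, hω⟩

/-- Series of bounded martingale differences with predictable, almost surely square-summable
weights converge almost surely. -/
theorem ae_exists_tendsto_sum_of_summable_sq {ℱ : Filtration ℕ mΩ} {b ξ : ℕ → Ω → ℝ}
    {C : ℝ} (hb : ∀ n, Measurable[ℱ n] (b n)) (hξ : ∀ n, Measurable[ℱ (n + 1)] (ξ n))
    (hC : ∀ n ω, |ξ n ω| ≤ C) (hξ0 : ∀ n, P[ξ n | ℱ n] =ᵐ[P] 0)
    (hsq : ∀ᵐ ω ∂P, Summable fun n => b n ω ^ 2) :
    ∀ᵐ ω ∂P, ∃ l, Tendsto (fun n => ∑ k ∈ Finset.range n, b k ω * ξ k ω) atTop (𝓝 l) := by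
  classical
  set V : ℕ → Ω → ℝ := fun n ω => ∑ k ∈ Finset.range n, b k ω ^ 2 with hV
  have hVm : ∀ n, Measurable[ℱ n] (V (n + 1)) := fun n =>
    Finset.measurable_fun_sum _ fun k hk =>
      ((hb k).mono (ℱ.mono (Nat.lt_succ_iff.1 (Finset.mem_range.1 hk))) le_rfl).pow_const 2
  -- Localisation: weights are cut off once their running sum of squares exceeds `L`. The sum `V (k
  -- + 1)` includes `b k` yet is known at time `k`, so the cut weights stay predictable. On a path
  -- with total at most `L` nothing is cut.
  have hall : ∀ᵐ ω ∂P, ∀ L : ℕ, ∃ l, Tendsto (fun n => ∑ k ∈ Finset.range n,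
      (if V (k + 1) ω ≤ L then b k ω else 0) * ξ k ω) atTop (𝓝 l) := by
    rw [ae_all_iff]
    intro L
    refine ae_exists_tendsto_sum_of_bounded_sum_sq (L := L)
      (b := fun k ω => if V (k + 1) ω ≤ L then b k ω else 0) ?_ hξ hC hξ0 ?_
    · intro n
      exact Measurable.ite (measurableSet_le (hVm n) measurable_const) (hb n) measurable_const
    · intro n ω
      induction n with
      | zero => simp
      | succ n ih =>
        rw [Finset.sum_range_succ]
        split_ifs with h
        · refine le_trans ?_ h
          have hle : ∀ k, (if V (k + 1) ω ≤ L then b k ω else 0) ^ 2 ≤ b k ω ^ 2 := fun k => by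
            split_ifs
            · exact le_rfl
            · simpa using sq_nonneg (b k ω)
          rw [show V (n + 1) ω = V n ω + b n ω ^ 2 from Finset.sum_range_succ _ _]
          exact add_le_add (Finset.sum_le_sum fun k _ => hle k) le_rfl
        · simpa using ih
  filter_upwards [hall, hsq] with ω h1 h2
  obtain ⟨L, hL⟩ := exists_nat_ge (∑' n, b n ω ^ 2)
  obtain ⟨l, hl⟩ := h1 L
  refine ⟨l, hl.congr fun n => Finset.sum_congr rfl fun k _ => ?_⟩
  rw [if_pos ((h2.sum_le_tsum _ fun _ _ => sq_nonneg _).trans hL)]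

end Martingale

/-! ### Contraction of the Bellman operator -/

section Bellman

variable {S A : Type*} [Fintype S]

theorem MDP.abs_sum_p_mul_le (M : MDP S A) {f : S → ℝ} {K : ℝ} (hf : ∀ j, |f j| ≤ K) (i : S) (a : A) :
    |∑ j, M.p i a j * f j| ≤ K := by
  calc |∑ j, M.p i a j * f j| ≤ ∑ j, |M.p i a j * f j| := Finset.abs_sum_le_sum_abs _ _
    _ ≤ ∑ j, M.p i a j * K := Finset.sum_le_sum fun j _ => by
        rw [abs_mul, abs_of_nonneg (M.p_nonneg i a j)]
        exact mul_le_mul_of_nonneg_left (hf j) (M.p_nonneg i a j)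
    _ = K := by rw [← Finset.sum_mul, M.p_sum, one_mul]

variable [Fintype A] [Nonempty A]

theorem abs_maxQ_sub_maxQ_le (Q Q' : S → A → ℝ) (j : S) :
    |maxQ Q j - maxQ Q' j| ≤ ‖Q - Q'‖ := by
  have key : ∀ Q Q' : S → A → ℝ, maxQ Q j ≤ maxQ Q' j + ‖Q - Q'‖ := by
    intro Q Q'
    refine Finset.sup'_le _ _ fun b hb => ?_
    have h1 : Q' j b ≤ maxQ Q' j := Finset.le_sup' (fun b => Q' j b) hb
    have h2 := (le_abs_self _).trans (abs_apply_le_norm (Q - Q') j b)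
    simp only [Pi.sub_apply] at h2
    linarith
  have h1 := key Q Q'
  have h2 := key Q' Q
  rw [norm_sub_rev] at h2
  exact abs_le.2 ⟨by linarith, by linarith⟩

theorem abs_maxQ_le (Q : S → A → ℝ) (j : S) : |maxQ Q j| ≤ ‖Q‖ := by
  have h0 : maxQ (0 : S → A → ℝ) j = 0 := by simp [maxQ]
  simpa [h0] using abs_maxQ_sub_maxQ_le Q 0 j

variable (M : MDP S A)

/-- This form exhibits `H Q` as the mean of the one-step sample, which is what centres the noise. -/
theorem MDP.bellman_eq_sum (Q : S → A → ℝ) (i : S) (a : A) :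
    M.bellman Q i a = ∑ j, M.p i a j * (M.c i a j + M.β * maxQ Q j) := by
  simp only [MDP.bellman, MDP.meanReward, mul_add, Finset.sum_add_distrib, Finset.mul_sum]
  congr 1
  exact Finset.sum_congr rfl fun j _ => by ring

theorem MDP.norm_bellman_sub_le (Q Q' : S → A → ℝ) :
    ‖M.bellman Q - M.bellman Q'‖ ≤ M.β * ‖Q - Q'‖ := by
  refine norm_le_of_abs_apply_le (mul_nonneg M.β_nonneg (norm_nonneg _)) fun i a => ?_
  have h : (M.bellman Q - M.bellman Q') i a
      = ∑ j, M.p i a j * (M.β * (maxQ Q j - maxQ Q' j)) := by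
    simp only [Pi.sub_apply, M.bellman_eq_sum, ← Finset.sum_sub_distrib]
    exact Finset.sum_congr rfl fun j _ => by ring
  rw [h]
  refine M.abs_sum_p_mul_le (fun j => ?_) i a
  rw [abs_mul, abs_of_nonneg M.β_nonneg]
  exact mul_le_mul_of_nonneg_left (abs_maxQ_sub_maxQ_le Q Q' j) M.β_nonneg

theorem MDP.contractingWith_bellman : ContractingWith ⟨M.β, M.β_nonneg⟩ M.bellman :=
  ⟨by exact_mod_cast M.β_lt_one, LipschitzWith.of_dist_le_mul fun Q Q' => by
    rw [dist_eq_norm, dist_eq_norm]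
    exact M.norm_bellman_sub_le Q Q'⟩

variable {M} {C : ℝ}

theorem MDP.abs_reward_add_le (hC : ∀ i a j, |M.c i a j| ≤ C) (Q : S → A → ℝ)
    (i : S) (a : A) (j k : S) : |M.c i a j + M.β * maxQ Q k| ≤ C + M.β * ‖Q‖ := by
  refine (abs_add_le _ _).trans (add_le_add (hC i a j) ?_)
  rw [abs_mul, abs_of_nonneg M.β_nonneg]
  exact mul_le_mul_of_nonneg_left (abs_maxQ_le Q k) M.β_nonneg

end Bellman

/-! ### Boundedness and decomposition of the iterates -/

section Iterates

variable {S A : Type*} [DecidableEq S] [DecidableEq A]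

theorem stepAt_mem {α : ℕ → S → A → ℝ} (hα : ∀ n i a, 0 ≤ α n i a ∧ α n i a ≤ 1)
    (x : ℕ → S) (u : ℕ → A) (i : S) (a : A) (n : ℕ) :
    0 ≤ stepAt α x u i a n ∧ stepAt α x u i a n ≤ 1 := by
  rw [stepAt]
  split_ifs
  · exact hα n i a
  · exact ⟨le_rfl, zero_le_one⟩

variable [Fintype S] [Fintype A] [Nonempty A] {M : MDP S A} {C : ℝ}

/-- The new entry is a convex combination of the old one and a target of size at most `(C + β B) (1
+ β |θ|)`. Separate `B` and `K` allow growth during the first iterations; later `B = K`. -/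
theorem MDP.norm_update_le (hC : ∀ i a j, |M.c i a j| ≤ C) {α : S → A → ℝ}
    (hα : ∀ i a, 0 ≤ α i a ∧ α i a ≤ 1) (θ : ℝ) {Q : S → A → ℝ} {B K : ℝ} (hB : ‖Q‖ ≤ B)
    (hBK : B ≤ K) (hK : (C + M.β * B) * (1 + M.β * |θ|) ≤ K) (i : S) (a : A) (j : S) (d : A) (k : S) :
    ‖M.update α θ Q i a j d k‖ ≤ K := by
  have hβ := M.β_nonneg
  have hQK := hB.trans hBK
  refine norm_le_of_abs_apply_le ((norm_nonneg _).trans hQK) fun s b => ?_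
  rw [MDP.update]
  split_ifs with h
  · obtain ⟨h0, h1⟩ := hα i a
    have hQ : |Q i a| ≤ K := (abs_apply_le_norm Q i a).trans hQK
    have hmono : C + M.β * ‖Q‖ ≤ C + M.β * B := by gcongr
    have hT1 := (M.abs_reward_add_le hC Q i a j j).trans hmono
    have hT2 := (M.abs_reward_add_le hC Q j d k k).trans hmono
    have hT3 : |M.β * θ * (M.c j d k + M.β * maxQ Q k)| ≤ M.β * |θ| * (C + M.β * B) := by
      rw [abs_mul, abs_mul, abs_of_nonneg hβ]
      exact mul_le_mul_of_nonneg_left hT2 (by positivity)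
    have hT : |M.c i a j + M.β * maxQ Q j + M.β * θ * (M.c j d k + M.β * maxQ Q k)| ≤ K :=
      (abs_add_le _ _).trans (by linarith)
    calc _ ≤ |(1 - α i a) * Q i a| + |α i a *
          (M.c i a j + M.β * maxQ Q j + M.β * θ * (M.c j d k + M.β * maxQ Q k))| :=
          abs_add_le _ _
      _ ≤ (1 - α i a) * K + α i a * K := by
          rw [abs_mul, abs_mul, abs_of_nonneg h0, abs_of_nonneg (sub_nonneg.2 h1)]
          exact add_le_add (mul_le_mul_of_nonneg_left hQ (sub_nonneg.2 h1))
            (mul_le_mul_of_nonneg_left hT h0)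
      _ = K := by ring
  · exact (abs_apply_le_norm Q s b).trans hQK

/-- The iterates stay below a bound that does not depend on the trajectory. -/
theorem MDP.exists_norm_iterate_le {Ω : Type*} (hC : ∀ i a j, |M.c i a j| ≤ C) (hC0 : 0 ≤ C)
    {α : ℕ → Ω → S → A → ℝ} (hα : ∀ n ω i a, 0 ≤ α n ω i a ∧ α n ω i a ≤ 1)
    {θ : ℕ → ℝ} (hθ : Tendsto (fun n => |θ n|) atTop (𝓝 0))
    {Q₀ : Ω → S → A → ℝ} {R : ℝ} (hR : ∀ ω, ‖Q₀ ω‖ ≤ R) (x : ℕ → Ω → S) (u : ℕ → Ω → A) :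
    ∃ B, ∀ n ω, ‖M.iterate (fun m => α m ω) θ (Q₀ ω) (fun t => x t ω) (fun t => u t ω) n‖
      ≤ B := by
  set Q := fun n ω => M.iterate (fun m => α m ω) θ (Q₀ ω) (fun t => x t ω) (fun t => u t ω) n
    with hQ
  have hβ := M.β_nonneg
  have hβ1 := M.β_lt_one
  have hstep : ∀ n ω B K, ‖Q n ω‖ ≤ B → B ≤ K → (C + M.β * B) * (1 + M.β * |θ n|) ≤ K →
      ‖Q (n + 1) ω‖ ≤ K := fun n ω B K h1 h2 h3 =>
    M.norm_update_le hC (fun i a => hα n ω i a) (θ n) h1 h2 h3 _ _ _ _ _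
  have hinit : ∀ n, ∃ B, 0 ≤ B ∧ ∀ m, m ≤ n → ∀ ω, ‖Q m ω‖ ≤ B := by
    intro n
    induction n with
    | zero =>
      refine ⟨|R|, abs_nonneg _, fun m hm ω => ?_⟩
      obtain rfl := Nat.le_zero.1 hm
      exact (hR ω).trans (le_abs_self R)
    | succ n ih =>
      obtain ⟨B, hB0, hB⟩ := ih
      refine ⟨B + (C + M.β * B) * (1 + M.β * |θ n|), by positivity, fun m hm ω => ?_⟩
      rcases Nat.le_succ_iff.1 hm with h | rfl
      · exact (hB m h ω).trans (le_add_of_nonneg_right (by positivity))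
      · exact hstep n ω B _ (hB n le_rfl ω) (le_add_of_nonneg_right (by positivity))
          (le_add_of_nonneg_left hB0)
  -- Up to time `N` the bound may grow. Afterwards `|θ n| ≤ (1 - β) / 2`, and `K ≥ 4 C / (1 - β)`
  -- gives `(C + β K) (1 + β |θ n|) ≤ K`, so the ball of radius `K` is invariant.
  obtain ⟨N, hN⟩ := eventually_atTop.1
    (hθ.eventually_lt_const (show (0 : ℝ) < (1 - M.β) / 2 by linarith))
  obtain ⟨B, hB0, hB⟩ := hinit N
  set K := max B (4 * C / (1 - M.β)) with hK
  have hKC : 4 * C ≤ (1 - M.β) * K := by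
    have : 4 * C / (1 - M.β) ≤ K := le_max_right _ _
    rw [div_le_iff₀ (by linarith)] at this
    linarith
  have hK0 : 0 ≤ K := hB0.trans (le_max_left _ _)
  refine ⟨K, fun n ω => ?_⟩
  rcases le_total n N with h | h
  · exact (hB n h ω).trans (le_max_left _ _)
  · induction n, h using Nat.le_induction with
    | base => exact (hB N le_rfl ω).trans (le_max_left _ _)
    | succ n hn ih =>
      refine hstep n ω K K ih le_rfl ?_
      have h1 : |θ n| ≤ (1 - M.β) / 2 := (hN n hn).le
      have h2 : M.β * |θ n| ≤ (1 - M.β) / 2 := by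
        nlinarith [abs_nonneg (θ n)]
      have h3 : (C + M.β * K) * (1 + M.β * |θ n|) ≤ (C + M.β * K) * (1 + (1 - M.β) / 2) := by
        gcongr
      nlinarith [mul_nonneg hβ hK0, mul_nonneg hK0 (sq_nonneg (1 - M.β)), mul_nonneg hβ hC0]

/-- The iteration as a relaxation of every entry, with noise and bias terms. -/
theorem MDP.iterate_succ_apply (α : ℕ → S → A → ℝ) (θ : ℕ → ℝ) (Q₀ : S → A → ℝ) (x : ℕ → S)
    (u : ℕ → A) (n : ℕ) (i : S) (a : A) :
    M.iterate α θ Q₀ x u (n + 1) i a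
      = (1 - stepAt α x u i a n) * M.iterate α θ Q₀ x u n i a
        + stepAt α x u i a n * (M.bellman (M.iterate α θ Q₀ x u n) i a
          + (M.c (x (2 * n)) (u (2 * n)) (x (2 * n + 1))
            + M.β * maxQ (M.iterate α θ Q₀ x u n) (x (2 * n + 1))
            - M.bellman (M.iterate α θ Q₀ x u n) (x (2 * n)) (u (2 * n)))
          + M.β * θ n * (M.c (x (2 * n + 1)) (u (2 * n + 1)) (x (2 * n + 2))
            + M.β * maxQ (M.iterate α θ Q₀ x u n) (x (2 * n + 2)))) := by
  rw [MDP.iterate, MDP.update, stepAt]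
  -- At the updated pair the two Bellman terms cancel; elsewhere the step is `0`. Hence a single
  -- noise sequence serves all entries.
  split_ifs with h
  · obtain ⟨rfl, rfl⟩ := h
    ring
  · ring

end Iterates

/-! ### Measurability through finite-valued variables -/

section Measurability

variable {Ω S A : Type*} {m : MeasurableSpace Ω}

theorem measurable_apply_of_finite [Fintype S] {X : Ω → S} (hX : ∀ i, MeasurableSet {ω | X ω = i})
    {f : S → Ω → ℝ} (hf : ∀ i, Measurable (f i)) : Measurable fun ω => f (X ω) ω := by
  classical
  have : (fun ω => f (X ω) ω) = fun ω => ∑ i, if X ω = i then f i ω else 0 := by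
    ext ω
    simp
  rw [this]
  exact Finset.measurable_fun_sum _ fun i _ => Measurable.ite (hX i) (hf i) measurable_const

theorem measurable_maxQ [Fintype A] [Nonempty A] {Q : Ω → S → A → ℝ}
    (hQ : ∀ i a, Measurable fun ω => Q ω i a) (j : S) : Measurable fun ω => maxQ (Q ω) j := by
  have h := Finset.measurable_sup' (f := fun b ω => Q ω j b) Finset.univ_nonempty
    fun b _ => hQ j b
  convert h using 1
  ext ω
  simp [maxQ]

theorem measurable_bellman [Fintype S] [Fintype A] [Nonempty A] (M : MDP S A)
    {Q : Ω → S → A → ℝ}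
    (hQ : ∀ i a, Measurable fun ω => Q ω i a) (i : S) (a : A) :
    Measurable fun ω => M.bellman (Q ω) i a :=
  ((Finset.measurable_fun_sum _ fun j _ =>
    (measurable_maxQ hQ j).const_mul (M.p i a j)).const_mul M.β).const_add _

end Measurability

/-! ### Adaptedness and conditional means along the trajectory -/

section Trajectory

variable {S A Ω : Type*} [Fintype S] [Fintype A] {mΩ : MeasurableSpace Ω}
  {P : Measure Ω} {M : MDP S A} {𝒢 : Filtration ℕ mΩ}
  {μ : ℕ → Ω → S → A → ℝ} {x : ℕ → Ω → S} {u : ℕ → Ω → A}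

theorem IsTrajectory.measurable_apply (h : IsTrajectory M P 𝒢 μ x u) {t s : ℕ} (hts : t ≤ s)
    {f : S → A → Ω → ℝ} (hf : ∀ i a, Measurable[𝒢 s] (f i a)) :
    Measurable[𝒢 s] fun ω => f (x t ω) (u t ω) ω :=
  measurable_apply_of_finite (f := fun i ω => f i (u t ω) ω)
    (fun i => 𝒢.mono hts _ (h.state_meas t i)) fun i =>
    measurable_apply_of_finite (f := fun a ω => f i a ω)
      (fun a => 𝒢.mono hts _ (h.action_meas t a)) (hf i)

theorem IsTrajectory.measurable_apply_state (h : IsTrajectory M P 𝒢 μ x u) {t s : ℕ}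
    (hts : t ≤ s) {f : S → Ω → ℝ} (hf : ∀ i, Measurable[𝒢 s] (f i)) :
    Measurable[𝒢 s] fun ω => f (x t ω) ω :=
  measurable_apply_of_finite (fun i => 𝒢.mono hts _ (h.state_meas t i)) hf

theorem IsTrajectory.measurable_stepAt [DecidableEq S] [DecidableEq A]
    (h : IsTrajectory M P 𝒢 μ x u)
    {α : ℕ → Ω → S → A → ℝ} (hα : ∀ n i a, Measurable[𝒢 (2 * n)] fun ω => α n ω i a)
    (n : ℕ) (i : S) (a : A) : Measurable[𝒢 (2 * n)] fun ω =>
      stepAt (fun m => α m ω) (fun t => x t ω) (fun t => u t ω) i a n := by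
  refine Measurable.ite ?_ (hα n i a) measurable_const
  have h1 := (h.state_meas (2 * n) i).inter (h.action_meas (2 * n) a)
  convert h1 using 1
  ext ω
  simp [eq_comm]

/-- The last state entering `Q_n` is `s''_{n-1} = x (2n)`, hence the time index `2 * n`. -/
theorem IsTrajectory.measurable_iterate [Nonempty A] [DecidableEq S] [DecidableEq A]
    (h : IsTrajectory M P 𝒢 μ x u)
    {α : ℕ → Ω → S → A → ℝ} (hα : ∀ n i a, Measurable[𝒢 (2 * n)] fun ω => α n ω i a)
    {θ : ℕ → ℝ} {Q₀ : Ω → S → A → ℝ} (hQ₀ : ∀ i a, Measurable[𝒢 0] fun ω => Q₀ ω i a)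
    (n : ℕ) : ∀ i a, Measurable[𝒢 (2 * n)] fun ω =>
      M.iterate (fun m => α m ω) θ (Q₀ ω) (fun t => x t ω) (fun t => u t ω) n i a := by
  induction n with
  | zero => exact hQ₀
  | succ n ih =>
    intro i a
    have hle : 𝒢 (2 * n) ≤ 𝒢 (2 * (n + 1)) := 𝒢.mono (by lia)
    have hs := (h.measurable_stepAt hα n i a).mono hle le_rfl
    have hQ := fun i a => (ih i a).mono hle le_rfl
    have hmax : ∀ t, t ≤ 2 * (n + 1) → Measurable[𝒢 (2 * (n + 1))] fun ω =>
        maxQ (M.iterate (fun m => α m ω) θ (Q₀ ω) (fun t => x t ω) (fun t => u t ω) n)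
          (x t ω) := fun t ht =>
      h.measurable_apply_state ht (f := fun j ω =>
        maxQ (M.iterate (fun m => α m ω) θ (Q₀ ω) (fun t => x t ω) (fun t => u t ω) n) j)
        (measurable_maxQ hQ)
    have hc : ∀ t, t + 1 ≤ 2 * (n + 1) → Measurable[𝒢 (2 * (n + 1))] fun ω =>
        M.c (x t ω) (u t ω) (x (t + 1) ω) := fun t ht =>
      h.measurable_apply (by lia) (f := fun i a ω => M.c i a (x (t + 1) ω)) fun i a =>
        h.measurable_apply_state ht (f := fun j _ => M.c i a j) fun _ => measurable_const
    have hbell := h.measurable_apply (t := 2 * n) (s := 2 * (n + 1)) (by lia)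
      (f := fun i a ω => M.bellman
        (M.iterate (fun m => α m ω) θ (Q₀ ω) (fun t => x t ω) (fun t => u t ω) n) i a)
      (measurable_bellman M hQ)
    simp only [MDP.iterate_succ_apply]
    exact ((hs.const_sub 1).mul (hQ i a)).add (hs.mul
      (((measurable_bellman M hQ i a).add
        (((hc (2 * n) (by lia)).add ((hmax (2 * n + 1) (by lia)).const_mul _)).sub hbell)).add
        (((hc (2 * n + 1) (by lia)).add ((hmax (2 * n + 2) (by lia)).const_mul _)).const_mul _)))

variable [IsProbabilityMeasure P]

/-- Summing over the next action removes the policy, whose weights add up to one; this is why the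
behaviour policy does not affect the limit. -/
theorem IsTrajectory.condExp_state (h : IsTrajectory M P 𝒢 μ x u) (t : ℕ) (j : S) :
    P⟦{ω | x (t + 1) ω = j} | 𝒢 t⟧ =ᵐ[P] fun ω => M.p (x t ω) (u t ω) j := by
  classical
  have hset : ∀ d, MeasurableSet {ω | x (t + 1) ω = j ∧ u (t + 1) ω = d} := fun d =>
    𝒢.le (t + 1) _ ((h.state_meas (t + 1) j).inter (h.action_meas (t + 1) d))
  have hsum : {ω | x (t + 1) ω = j}.indicator (fun _ => (1 : ℝ))
      = ∑ d, {ω | x (t + 1) ω = j ∧ u (t + 1) ω = d}.indicator (fun _ => (1 : ℝ)) := by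
    ext ω
    by_cases hj : x (t + 1) ω = j <;> simp [Set.indicator_apply, Finset.sum_apply, hj]
  have hce := condExp_finsetSum (m := 𝒢 t) (μ := P) (s := Finset.univ)
    (f := fun d => {ω | x (t + 1) ω = j ∧ u (t + 1) ω = d}.indicator (fun _ => (1 : ℝ)))
    fun d _ => (integrable_const (1 : ℝ)).indicator (hset d)
  have htr : ∀ᵐ ω ∂P, ∀ d, (P⟦{ω | x (t + 1) ω = j ∧ u (t + 1) ω = d} | 𝒢 t⟧) ω
      = M.p (x t ω) (u t ω) j * μ t ω j d := ae_all_iff.2 fun d => h.transition t j d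
  rw [hsum]
  filter_upwards [hce, htr] with ω h1 h2
  rw [h1, Finset.sum_apply, Finset.sum_congr rfl fun d _ => h2 d, ← Finset.mul_sum,
    (h.policy t ω).sum_eq_one, mul_one]

/-- A function of the next state, minus its mean under the transition law, has conditional
expectation zero. -/
theorem IsTrajectory.condExp_sub_mean_eq_zero (h : IsTrajectory M P 𝒢 μ x u) (t : ℕ)
    {g : S → Ω → ℝ} {K : ℝ} (hg : ∀ j, Measurable[𝒢 t] (g j)) (hK : ∀ j ω, |g j ω| ≤ K) :
    P[fun ω => g (x (t + 1) ω) ω - ∑ j, M.p (x t ω) (u t ω) j * g j ω | 𝒢 t] =ᵐ[P] 0 := by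
  classical
  set I : S → Ω → ℝ := fun j => {ω | x (t + 1) ω = j}.indicator (fun _ => (1 : ℝ)) with hI
  set q : S → Ω → ℝ := fun j ω => M.p (x t ω) (u t ω) j with hq
  have hIi : ∀ j, Integrable (I j) P := fun j =>
    (integrable_const (1 : ℝ)).indicator (𝒢.le (t + 1) _ (h.state_meas (t + 1) j))
  have hqm : ∀ j, Measurable[𝒢 t] (q j) := fun j =>
    h.measurable_apply le_rfl (f := fun i a _ => M.p i a j) fun _ _ => measurable_const
  have hqi : ∀ j, Integrable (q j) P := fun j => by
    refine Integrable.of_bound ((hqm j).mono (𝒢.le t) le_rfl).aestronglyMeasurable 1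
      (Eventually.of_forall fun ω => ?_)
    rw [Real.norm_of_nonneg (M.p_nonneg _ _ _), ← M.p_sum (x t ω) (u t ω)]
    exact Finset.single_le_sum (fun j _ => M.p_nonneg (x t ω) (u t ω) j) (Finset.mem_univ j)
  have hprod : ∀ j, Integrable (g j * (I j - q j)) P := fun j =>
    ((hIi j).sub (hqi j)).bdd_mul ((hg j).mono (𝒢.le t) le_rfl).aestronglyMeasurable
      (Eventually.of_forall (hK j))
  -- Expanding over the value of the next state leaves factors `g j` known at time `t`, which come
  -- out of the conditional expectation, times centred indicators.
  have hrw : (fun ω => g (x (t + 1) ω) ω - ∑ j, M.p (x t ω) (u t ω) j * g j ω)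
      = ∑ j, g j * (I j - q j) := by
    ext ω
    simp [hI, hq, Set.indicator_apply, Finset.sum_apply, mul_sub, Finset.sum_sub_distrib,
      mul_comm]
  have hzero : ∀ᵐ ω ∂P, ∀ j, (P[g j * (I j - q j) | 𝒢 t]) ω = 0 := by
    refine ae_all_iff.2 fun j => ?_
    have h1 := condExp_mul_of_stronglyMeasurable_left (hg j).stronglyMeasurable (hprod j)
      ((hIi j).sub (hqi j))
    have h2 := condExp_sub (hIi j) (hqi j) (𝒢 t)
    rw [condExp_of_stronglyMeasurable (𝒢.le t) (hqm j).stronglyMeasurable (hqi j)] at h2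
    filter_upwards [h1, h2, h.condExp_state t j] with ω h1 h2 h3
    rw [h1, Pi.mul_apply, h2, Pi.sub_apply]
    rw [show (P[I j | 𝒢 t]) ω = q j ω from h3]
    simp
  rw [hrw]
  filter_upwards [condExp_finsetSum (s := Finset.univ) (fun j _ => hprod j) (𝒢 t), hzero]
    with ω h1 h2
  rw [h1, Finset.sum_apply]
  simp [h2]

end Trajectory

end TSQL

/-! ### Convergence of two-step Q-learning -/

theorem theorem2 {S A Ω : Type*} [Fintype S] [Fintype A] [Nonempty A]
    [DecidableEq S] [DecidableEq A] {mΩ : MeasurableSpace Ω}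
    (P : Measure Ω) [IsProbabilityMeasure P]
    -- the decision process, with rewards bounded by `Cmax`
    (M : TSQL.MDP S A) (Cmax : ℝ) (hC : ∀ i a j, |M.c i a j| ≤ Cmax)
    -- the trajectory generated by the behaviour policy
    (𝒢 : Filtration ℕ mΩ) (μ : ℕ → Ω → S → A → ℝ) (x : ℕ → Ω → S) (u : ℕ → Ω → A)
    (htraj : TSQL.IsTrajectory M P 𝒢 μ x u)
    (hvisit : ∀ᵐ ω ∂P, ∀ i a, ∃ᶠ n in atTop, x (2 * n) ω = i ∧ u (2 * n) ω = a)
    -- the initial values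
    (Q₀ : Ω → S → A → ℝ) (hQ₀_meas : ∀ i a, Measurable[𝒢 0] (fun ω => Q₀ ω i a))
    (hQ₀ : ∀ ω, ‖Q₀ ω‖ ≤ Cmax / (1 - M.β))
    -- the step sizes
    (α : ℕ → Ω → S → A → ℝ)
    (hα_meas : ∀ n i a, Measurable[𝒢 (2 * n)] (fun ω => α n ω i a))
    (hα : ∀ n ω i a, 0 ≤ α n ω i a ∧ α n ω i a ≤ 1)
    (hα_sum : ∀ᵐ ω ∂P, ∀ i a, Tendsto (fun N => ∑ n ∈ Finset.range N,
      TSQL.stepAt (fun m => α m ω) (fun t => x t ω) (fun t => u t ω) i a n) atTop atTop)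
    (hα_sq : ∀ᵐ ω ∂P, ∀ i a, Summable (fun n =>
      (TSQL.stepAt (fun m => α m ω) (fun t => x t ω) (fun t => u t ω) i a n) ^ 2))
    -- the parameters `θ n`
    (θ : ℕ → ℝ) (hθ_le : ∀ n, |θ n| ≤ 1) (hθ_anti : Antitone (fun n => |θ n|))
    (hθ_lim : Tendsto (fun n => |θ n|) atTop (𝓝 0))
    (hαθ : ∀ᵐ ω ∂P, ∀ i a, Summable (fun n =>
      TSQL.stepAt (fun m => α m ω) (fun t => x t ω) (fun t => u t ω) i a n * |θ n|)) :
    ∃ Qstar : S → A → ℝ,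
      (M.bellman Qstar = Qstar ∧ ∀ Q : S → A → ℝ, M.bellman Q = Q → Q = Qstar) ∧
      ∀ᵐ ω ∂P, Tendsto
        (fun n => M.iterate (fun m => α m ω) θ (Q₀ ω) (fun t => x t ω) (fun t => u t ω) n)
        atTop (𝓝 Qstar) := by
  have hfp := M.contractingWith_bellman
  refine ⟨hfp.fixedPoint, ⟨hfp.fixedPoint_isFixedPt, fun Q hQ => hfp.fixedPoint_unique hQ⟩, ?_⟩
  obtain ⟨ω₀⟩ : Nonempty Ω := P.nonempty_of_neZero
  have hC0 : 0 ≤ Cmax := (abs_nonneg _).trans (hC (x 0 ω₀) (u 0 ω₀) (x 0 ω₀))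
  obtain ⟨B, hB⟩ := M.exists_norm_iterate_le hC hC0 hα hθ_lim hQ₀ x u
  set Q : ℕ → Ω → S → A → ℝ := fun n ω =>
    M.iterate (fun m => α m ω) θ (Q₀ ω) (fun t => x t ω) (fun t => u t ω) n with hQdef
  have hQm : ∀ n i a, Measurable[𝒢 (2 * n)] fun ω => Q n ω i a :=
    htraj.measurable_iterate hα_meas hQ₀_meas
  have hβ := M.β_nonneg
  have hrew : ∀ n ω i a j k, |M.c i a j + M.β * TSQL.maxQ (Q n ω) k| ≤ Cmax + M.β * B :=
    fun n ω i a j k => (M.abs_reward_add_le hC (Q n ω) i a j k).trans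
      (by gcongr; exact hB n ω)
  -- One iteration spans two transitions. At time `2 * n` the pair `(s_n, a_n)`, the step size and
  -- `Q_n` are known, but `s'_n` is not.
  let ℱ : Filtration ℕ mΩ :=
    ⟨fun n => 𝒢 (2 * n), fun m n hmn => 𝒢.mono (by lia), fun n => 𝒢.le _⟩
  set ξ : ℕ → Ω → ℝ := fun n ω => M.c (x (2 * n) ω) (u (2 * n) ω) (x (2 * n + 1) ω)
    + M.β * TSQL.maxQ (Q n ω) (x (2 * n + 1) ω)
    - M.bellman (Q n ω) (x (2 * n) ω) (u (2 * n) ω) with hξ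
  have hgm : ∀ n j, Measurable[𝒢 (2 * n)] fun ω =>
      M.c (x (2 * n) ω) (u (2 * n) ω) j + M.β * TSQL.maxQ (Q n ω) j := fun n j =>
    (htraj.measurable_apply le_rfl (f := fun i a _ => M.c i a j)
      fun _ _ => measurable_const).add ((TSQL.measurable_maxQ (hQm n) j).const_mul _)
  have hξm : ∀ n, Measurable[ℱ (n + 1)] (ξ n) := fun n => by
    have hle : 𝒢 (2 * n) ≤ 𝒢 (2 * (n + 1)) := 𝒢.mono (by lia)
    exact (htraj.measurable_apply_state (by lia) (f := fun j ω =>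
      M.c (x (2 * n) ω) (u (2 * n) ω) j + M.β * TSQL.maxQ (Q n ω) j)
      fun j => (hgm n j).mono hle le_rfl).sub
      ((htraj.measurable_apply le_rfl (f := fun i a ω => M.bellman (Q n ω) i a)
        (TSQL.measurable_bellman M (hQm n))).mono hle le_rfl)
  have hξb : ∀ n ω, |ξ n ω| ≤ (Cmax + M.β * B) + (Cmax + M.β * B) := fun n ω => by
    refine (abs_sub _ _).trans (add_le_add (hrew _ _ _ _ _ _) ?_)
    rw [M.bellman_eq_sum]
    exact M.abs_sum_p_mul_le (fun j => hrew _ _ _ _ _ _) _ _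
  have hξ0 : ∀ n, P[ξ n | ℱ n] =ᵐ[P] 0 := fun n => by
    have := htraj.condExp_sub_mean_eq_zero (2 * n) (hgm n) fun j ω => hrew n ω _ _ j j
    simpa only [hξ, M.bellman_eq_sum] using this
  have hnoise : ∀ᵐ ω ∂P, ∀ i a, ∃ l, Tendsto (fun n => ∑ k ∈ Finset.range n,
      TSQL.stepAt (fun m => α m ω) (fun t => x t ω) (fun t => u t ω) i a k * ξ k ω)
      atTop (𝓝 l) := by
    refine ae_all_iff.2 fun i => ae_all_iff.2 fun a => ?_
    exact TSQL.ae_exists_tendsto_sum_of_summable_sq (ℱ := ℱ)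
      (fun n => htraj.measurable_stepAt hα_meas n i a) hξm hξb hξ0
      (hα_sq.mono fun ω hω => hω i a)
  filter_upwards [hnoise, hα_sum] with ω hω hsum
  refine TSQL.tendsto_fixedPoint_of_async_approximation (H := M.bellman) (B := B) hβ M.β_lt_one
    (fun Q => ?_)
    (a := fun n i a => TSQL.stepAt (fun m => α m ω) (fun t => x t ω) (fun t => u t ω) i a n)
    (w := fun n _ _ => ξ n ω)
    (e := fun n _ _ => M.β * θ n * (M.c (x (2 * n + 1) ω) (u (2 * n + 1) ω) (x (2 * n + 2) ω)
      + M.β * TSQL.maxQ (Q n ω) (x (2 * n + 2) ω)))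
    (fun n i a => TSQL.stepAt_mem (fun n i a => hα n ω i a) _ _ i a n) hsum
    (fun n => hB n ω) hω ?_ ?_
  · have := M.norm_bellman_sub_le Q hfp.fixedPoint
    rwa [hfp.fixedPoint_isFixedPt.eq] at this
  · refine tendsto_pi_nhds.2 fun i => tendsto_pi_nhds.2 fun a => ?_
    -- The two-step term needs no averaging: it is `θ n` times a bounded quantity.
    have hlim : Tendsto (fun n => M.β * |θ n| * (Cmax + M.β * B)) atTop (𝓝 0) := by
      simpa using (hθ_lim.const_mul M.β).mul_const (Cmax + M.β * B)
    refine squeeze_zero_norm (fun n => ?_) hlim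
    rw [Real.norm_eq_abs, abs_mul, abs_mul, abs_of_nonneg hβ]
    exact mul_le_mul_of_nonneg_left (hrew _ _ _ _ _ _) (by positivity)
  · intro n i a
    exact M.iterate_succ_apply _ _ _ _ _ n i a
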